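/- \textbf{Setting.} Let $X_1,\dots,X_n$ be Polish spaces with their Borel $\sigma$-algebras, let $\mu_k$ be a Borel probability measure on $X_k$, and put $X=X_1\times\dots\times X_n$, $\mu=(\mu_1,\dots,\mu_n)$, with coordinate projections $\operatorname{Pr}_k:X\to X_k$. Let $C_L(\mu_k)$ be the space of continuous $\mu_k$-integrable functions $X_k\to\mathbb R$, and let $C_L(\mu)$ be the space of continuous functions $h:X\to\mathbb R$ such that $|h(x)|\le\sum_{k=1}^n f_k(x_k)$ for all $x\in X$, for some $f_k\in C_L(\mu_k)$. For a linear subspace $W\subset C_L(\mu)$ let $\Pi_W(\mu)$ be the set of Borel probability measures $\pi$ on $X$ with $(\operatorname{Pr}_k)_\#\pi=\mu_k$ for all $k$ and $\int_X w\,d\pi=0$ for all $w\in W$. For (nonnegative) measures $\alpha,\beta$ on $X$ write $\alpha\sim_W\beta$ if $(\operatorname{Pr}_k)_\#\alpha=(\operatorname{Pr}_k)_\#\beta$ for all $k$ and $\int w\,d\alpha=\int w\,d\beta$ for all $w\in W$. A set $\Gamma\subset X$ is called \emph{$(c,W)$-monotone} if $\int_X c\,d\beta\le\int_X c\,d\alpha$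 for every finite measure $\beta$ whose support is a finite subset of $\Gamma$ and every measure $\alpha\sim_W\beta$. A plan $\pi\in\Pi_W(\mu)$ is called \emph{$(c,W)$-monotone} if $\pi(\Gamma)=1$ for some Borel $(c,W)$-monotone set $\Gamma\subset X$. \textbf{Theorem (necessity of $(c,W)$-monotonicity).} Let $c\in C_L(\mu)$, let $W\subset C_L(\mu)$ be a linear subspace, and assume that $\int_{X_k} f\,d\mu_k=0$ for every $k$ and every $f\in C_L(\mu_k)$ with $f\circ\operatorname{Pr}_k\in W$. Let $\pi_*\in\Pi_W(\mu)$ be a minimizer of $\pi\mapsto\int_X c\,d\pi$ over $\Pi_W(\mu)$. Then $\pi_*$ is a $(c,W)$-monotone transport plan. -/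

import Mathlib

open MeasureTheory

noncomputable section

namespace ConstrainedTransport

/-- The space `C_L(ν)` of continuous functions on `Y` that are absolutely integrable
with respect to `ν`. -/
def CLMarginal {Y : Type*} [TopologicalSpace Y] [MeasurableSpace Y] [BorelSpace Y]
    (ν : Measure Y) : Submodule ℝ C(Y, ℝ) where
  carrier := {f | Integrable (fun y => f y) ν}
  add_mem' := by
    intro f g hf hg
    exact Integrable.add hf hg
  zero_mem' := integrable_zero Y ℝ ν
  smul_mem' := by
    intro a f hf
    exact Integrable.smul a hf

variable {n : ℕ} {X : Fin n → Type*} [∀ i, TopologicalSpace (X i)]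
  [∀ i, MeasurableSpace (X i)] [∀ i, BorelSpace (X i)]

/-- The space `C_L(μ)` of continuous functions `h` on the product `X₁ × ⋯ × Xₙ` such that
`|h| ≤ f₁(x₁) + ⋯ + fₙ(xₙ)` for some `fᵢ ∈ C_L(μᵢ)`. -/
def CL (μ : ∀ i, Measure (X i)) : Submodule ℝ C(∀ i, X i, ℝ) where
  carrier := {h | ∃ f : ∀ i, C(X i, ℝ), (∀ i, f i ∈ CLMarginal (μ i)) ∧
    ∀ x : ∀ i, X i, |h x| ≤ ∑ i, f i (x i)}
  add_mem' := by
    rintro h g ⟨f, hf, hle⟩ ⟨f', hf', hle'⟩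
    refine ⟨fun i => f i + f' i, fun i => (CLMarginal (μ i)).add_mem (hf i) (hf' i), fun x => ?_⟩
    simp only [ContinuousMap.add_apply, Finset.sum_add_distrib]
    exact (abs_add_le _ _).trans (add_le_add (hle x) (hle' x))
  zero_mem' := ⟨fun _ => 0, fun i => (CLMarginal (μ i)).zero_mem, fun x => by simp⟩
  smul_mem' := by
    rintro a h ⟨f, hf, hle⟩
    refine ⟨fun i => |a| • f i, fun i => (CLMarginal (μ i)).smul_mem _ (hf i), fun x => ?_⟩
    simp only [ContinuousMap.smul_apply, smul_eq_mul, abs_mul, ← Finset.mul_sum]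
    exact mul_le_mul_of_nonneg_left (hle x) (abs_nonneg a)

/-- The `k`-th coordinate projection `Pr_k`, as a continuous map. -/
def proj (k : Fin n) : C(∀ i, X i, X k) := ⟨fun x => x k, continuous_apply k⟩

/-- The set `Π_W(μ)` of Borel probability measures on the product with marginals `μ₁, …, μₙ`
that vanish on `W`. -/
def PlansVanishingOn (μ : ∀ i, Measure (X i)) (W : Submodule ℝ C(∀ i, X i, ℝ)) :
    Set (Measure (∀ i, X i)) :=
  {π | IsProbabilityMeasure π ∧ (∀ k, π.map (proj k) = μ k) ∧ ∀ w ∈ W, ∫ x, w x ∂π = 0}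

/-- The relation `α ∼_W β`: the two measures have the same marginals and the same integrals
against every element of `W`. -/
def WEquiv (W : Submodule ℝ C(∀ i, X i, ℝ)) (α β : Measure (∀ i, X i)) : Prop :=
  (∀ k, α.map (proj k) = β.map (proj k)) ∧ ∀ w ∈ W, ∫ x, w x ∂α = ∫ x, w x ∂β

/-- `Γ` is `(c, W)`-monotone: `∫ c dβ ≤ ∫ c dα` for every (finite) measure `β` whose support is a
finite subset of `Γ` and every measure `α ∼_W β`. As such an `α` shares its marginals with `β`,
it is itself finite and carried by finitely many points, so that all functions are integrable. -/
def IsCWMonotone (c : (∀ i, X i) → ℝ) (W : Submodule ℝ C(∀ i, X i, ℝ))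
    (Γ : Set (∀ i, X i)) : Prop :=
  ∀ S : Finset (∀ i, X i), (S : Set (∀ i, X i)) ⊆ Γ →
    ∀ β : Measure (∀ i, X i), IsFiniteMeasure β → β.support = (S : Set (∀ i, X i)) →
      ∀ α : Measure (∀ i, X i), WEquiv W α β → ∫ x, c x ∂β ≤ ∫ x, c x ∂α

/-- `π` is a `(c, W)`-monotone transport plan: it belongs to `Π_W(μ)` and is concentrated on a
(Borel) `(c, W)`-monotone set. -/
def IsCWMonotonePlan (μ : ∀ i, Measure (X i)) (c : (∀ i, X i) → ℝ)
    (W : Submodule ℝ C(∀ i, X i, ℝ)) (π : Measure (∀ i, X i)) : Prop :=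
  π ∈ PlansVanishingOn μ W ∧ ∃ Γ : Set (∀ i, X i),
    MeasurableSet Γ ∧ π Γ = 1 ∧ IsCWMonotone c W Γ

end ConstrainedTransport

end

noncomputable section

namespace ConstrainedTransport

open Filter Topology
open scoped BoundedContinuousFunction CompactlySupported

/-! Optimality gives almost optimal dual potentials: for each `ε > 0` there are `fᵢ` and `w ∈ W`
whose slack `s = c + ∑ fᵢ + w` is nonnegative with `∫ s dπ ≤ ε`. Along a subsequence the slacks tend
to zero `π`-a.e.; `Γ` is the set where they do. If `β` is finitely supported in `Γ` and `α ∼_W β`,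
then `∑ fᵢ + w` has the same integral against both, so `∫ c dα - ∫ c dβ = ∫ s dα - ∫ s dβ ≥ -∫ s
dβ`, which tends to zero.

The potentials come from duality without a gap (`exists_dual_slack_le`). The infimum of the dual
values is a finite sublinear functional on `C_L(μ)`, and Hahn–Banach yields a linear functional
below it that attains it at `-c` (`exists_isCoupling_apply_eq_sInf`). This functional is positive,
has the right marginals and kills `W`. Its marginals make it tight, so it is integration against a
plan (`IsCoupling.exists_measure`), with which `π` is compared. -/

/-! ### Tight positive functionals as measures -/

/-- Riesz representation on the Stone–Čech compactification gives a measure there; tightness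
concentrates it on the image of a σ-compact subset of `Z`, from which it is pulled back. -/
theorem exists_measure_of_tight_functional {Z : Type*} [TopologicalSpace Z] [T35Space Z]
    [MeasurableSpace Z] [BorelSpace Z] (L : (Z →ᵇ ℝ) →ₗ[ℝ] ℝ) (hpos : ∀ g, 0 ≤ g → 0 ≤ L g)
    (htight : ∀ ε : ℝ, 0 < ε → ∃ K : Set Z, IsCompact K ∧
      ∀ g : Z →ᵇ ℝ, (∀ x, g x ∈ Set.Icc (0 : ℝ) 1) → (∀ x ∈ K, g x = 0) → L g ≤ ε) :
    ∃ ρ : Measure Z, IsFiniteMeasure ρ ∧ ∀ g : Z →ᵇ ℝ, ∫ x, g x ∂ρ = L g := by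
  borelize (StoneCech Z)
  let i : Z → StoneCech Z := stoneCechUnit
  have hi : Topology.IsEmbedding i := isEmbedding_stoneCechUnit
  let restr : C_c(StoneCech Z, ℝ) →ₗ[ℝ] (Z →ᵇ ℝ) :=
    { toFun := fun f => (BoundedContinuousFunction.mkOfCompact f.toContinuousMap).compContinuous
        ⟨i, continuous_stoneCechUnit⟩
      map_add' := fun f g => by ext; rfl
      map_smul' := fun a f => by ext; rfl }
  let Λ : C_c(StoneCech Z, ℝ) →ₚ[ℝ] ℝ := PositiveLinearMap.mk₀ (L.comp restr)
    fun f hf => hpos _ fun x => hf (i x)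
  have hΛ : ∀ f, Λ f = L (restr f) := fun f => rfl
  let ν := RealRMK.rieszMeasure Λ
  have hν : ∀ ε : ℝ, 0 < ε → ∃ K : Set Z, IsCompact K ∧ ν (i '' K)ᶜ ≤ ENNReal.ofReal ε := by
    intro ε hε
    obtain ⟨K, hK, hKL⟩ := htight ε hε
    have hiK : IsClosed (i '' K) := (hK.image hi.continuous).isClosed
    refine ⟨K, hK, le_of_forall_lt fun r hr => ?_⟩
    -- A Urysohn function that is 0 on `i '' K` and 1 on `C` bounds `ν C` by a value of `L` that
    -- tightness controls.
    obtain ⟨C, hCsub, hC, hrC⟩ := (Measure.Regular.innerRegular (μ := ν)) hiK.isOpen_compl r hr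
    obtain ⟨g, hg0, hg1, hg01⟩ := exists_continuous_zero_one_of_isClosed hiK hC.isClosed
      (Set.disjoint_left.2 fun x hx hxC => hCsub hxC hx)
    refine hrC.trans_le ((RealRMK.rieszMeasure_le_of_eq_one Λ
      (f := CompactlySupportedContinuousMap.continuousMapEquiv g) (fun x => (hg01 x).1) hC
      fun x hx => hg1 hx).trans ?_)
    refine ENNReal.ofReal_le_ofReal ?_
    rw [hΛ]
    exact hKL _ (fun x => hg01 (i x)) fun x hx => hg0 ⟨x, hx, rfl⟩
  choose! K hK hKν using hν
  -- The image of `B` is σ-compact, hence Borel, which is not known for the image of all of `Z`.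
  let B : Set Z := ⋃ m : ℕ, K (1 / ((m : ℝ) + 1))
  have hpos' : ∀ m : ℕ, (0 : ℝ) < 1 / ((m : ℝ) + 1) := fun m => Nat.one_div_pos_of_nat
  have hB : MeasurableSet B := MeasurableSet.iUnion fun m => (hK _ (hpos' m)).isClosed.measurableSet
  have hiB : MeasurableSet (i '' B) := by
    rw [Set.image_iUnion]
    exact MeasurableSet.iUnion fun m =>
      ((hK _ (hpos' m)).image hi.continuous).isClosed.measurableSet
  have hνB : ν (i '' B)ᶜ = 0 := by
    have hle : ∀ m : ℕ, ν (i '' B)ᶜ ≤ ENNReal.ofReal (1 / ((m : ℝ) + 1)) := fun m =>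
      (measure_mono (Set.compl_subset_compl.2 (Set.image_mono
        (Set.subset_iUnion (fun m : ℕ => K (1 / ((m : ℝ) + 1))) m)))).trans (hKν _ (hpos' m))
    refine le_antisymm (ge_of_tendsto' (x := atTop) ?_ hle) zero_le
    simpa using ENNReal.tendsto_ofReal tendsto_one_div_add_atTop_nhds_zero_nat
  let e : B → StoneCech Z := fun b => i b
  have hrange : Set.range e = i '' B := by
    ext y; simp [e]
  have he : MeasurableEmbedding e :=
    (hi.comp Topology.IsEmbedding.subtypeVal).measurableEmbedding (by
      change MeasurableSet (Set.range e); rwa [hrange])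
  have hmap : (ν.comap e).map e = ν := by
    rw [he.map_comap, hrange]
    exact Measure.restrict_eq_self_of_ae_mem hνB
  have hfin : IsFiniteMeasure (ν.comap e) := ⟨by
    rw [he.comap_apply]; exact measure_lt_top _ _⟩
  refine ⟨(ν.comap e).map Subtype.val, inferInstance, fun g => ?_⟩
  have hgb : ∀ x, g x ∈ Set.Icc (-‖g‖) ‖g‖ := fun x => abs_le.1 (g.norm_coe_le_norm x)
  -- With values in a compact interval, `g` extends continuously to the compactification.
  have hgc : Continuous (fun x => ⟨g x, hgb x⟩ : Z → Set.Icc (-‖g‖) ‖g‖) := by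
    fun_prop
  have hGc := continuous_stoneCechExtend hgc
  let G : C(StoneCech Z, ℝ) := 
    ⟨Subtype.val ∘ stoneCechExtend hgc, continuous_subtype_val.comp hGc⟩
  have hG : ∀ x, G (i x) = g x := fun x => by
    simp [G, i, stoneCechExtend_stoneCechUnit]
  rw [(MeasurableEmbedding.subtype_coe hB).integral_map]
  calc ∫ b : B, g b ∂(ν.comap e) = ∫ b, G (e b) ∂(ν.comap e) := by simp [e, hG]
    _ = ∫ y, G y ∂ν := by rw [← he.integral_map, hmap]
    _ = Λ (CompactlySupportedContinuousMap.continuousMapEquiv G) :=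
      RealRMK.integral_rieszMeasure Λ (CompactlySupportedContinuousMap.continuousMapEquiv G)
    _ = L g := by
      rw [hΛ]
      congr 1
      ext x
      exact hG x

/-- A compact box has a uniform thickening inside `U`. In the sup metric, a point outside that
thickening has some coordinate far from `K i`. -/
theorem exists_continuousMap_separating_pi {n : ℕ} {X : Fin n → Type*}
    [∀ i, TopologicalSpace (X i)] [∀ i, TopologicalSpace.MetrizableSpace (X i)]
    (K : ∀ i, Set (X i)) (hK : ∀ i, IsCompact (K i)) (U : Set (∀ i, X i)) (hU : IsOpen U)
    (hKU : Set.pi Set.univ K ⊆ U) :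
    ∃ φ : ∀ i, C(X i, ℝ), (∀ i y, φ i y ∈ Set.Icc (0 : ℝ) 1) ∧ (∀ i, ∀ y ∈ K i, φ i y = 0) ∧
      ∀ x ∉ U, ∃ i, φ i (x i) = 1 := by
  let _ := fun i => TopologicalSpace.metrizableSpaceMetric (X i)
  obtain ⟨η, hη, hηU⟩ := (isCompact_univ_pi hK).exists_thickening_subset_open hU hKU
  refine ⟨fun i => ⟨fun y => 1 - (thickenedIndicator hη (K i) y : ℝ), by fun_prop⟩,
    fun i y => ⟨?_, ?_⟩, fun i y hy => ?_, fun x hx => ?_⟩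
  · have := thickenedIndicator_le_one hη (K i) y
    have : (thickenedIndicator hη (K i) y : ℝ) ≤ 1 := by exact_mod_cast this
    simpa using this
  · simp
  · have := thickenedIndicator_one hη (K i) hy
    change 1 - (thickenedIndicator hη (K i) y : ℝ) = 0
    simp only [this, NNReal.coe_one, sub_self]
  · by_contra! hcon
    have hmem : ∀ i, x i ∈ Metric.thickening η (K i) := by
      intro i
      by_contra hi
      refine hcon i ?_
      have := thickenedIndicator_zero hη (K i) hi
      change 1 - (thickenedIndicator hη (K i) (x i) : ℝ) = 1
      simp only [this, NNReal.coe_zero, sub_zero]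
    simp only [Metric.mem_thickening_iff] at hmem
    choose z hz hzd using hmem
    refine hx (hηU (Metric.mem_thickening_iff.2 ⟨z, fun i _ => hz i, ?_⟩))
    exact (dist_pi_lt_iff hη).2 hzd

/-! ### Functionals on `C_L(μ)` with prescribed marginals -/

section

variable {n : ℕ} {X : Fin n → Type*} [∀ i, TopologicalSpace (X i)]
  [∀ i, MeasurableSpace (X i)] [∀ i, BorelSpace (X i)] {μ : ∀ i, Measure (X i)}

theorem mem_CL_of_abs_le {h : C(∀ i, X i, ℝ)} {f : ∀ i, C(X i, ℝ)}
    (hf : ∀ i, f i ∈ CLMarginal (μ i)) (hle : ∀ x, |h x| ≤ ∑ i, f i (x i)) : h ∈ CL μ :=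
  ⟨f, hf, hle⟩

theorem abs_mem_CLMarginal {k : Fin n} {f : C(X k, ℝ)} (hf : f ∈ CLMarginal (μ k)) :
    |f| ∈ CLMarginal (μ k) :=
  Integrable.abs (f := fun y => f y) hf

theorem comp_proj_mem_CL {k : Fin n} {f : C(X k, ℝ)} (hf : f ∈ CLMarginal (μ k)) :
    f.comp (proj k) ∈ CL μ := by
  classical
  refine mem_CL_of_abs_le (f := Pi.single k |f|) (fun i => ?_) fun x => ?_
  · rcases eq_or_ne i k with rfl | hik
    · simpa using abs_mem_CLMarginal hf
    · simp [hik]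
  · rw [Finset.sum_eq_single k]
    · simp [proj]
    · intro i _ hik
      simp [hik]
    · simp

theorem const_mem_CLMarginal [∀ i, IsFiniteMeasure (μ i)] (k : Fin n) (a : ℝ) :
    ContinuousMap.const (X k) a ∈ CLMarginal (μ k) :=
  integrable_const a

theorem mem_CL_of_bounded [∀ i, IsFiniteMeasure (μ i)] (k : Fin n) {h : C(∀ i, X i, ℝ)} {a : ℝ}
    (ha : ∀ x, |h x| ≤ a) : h ∈ CL μ := by
  refine mem_CL_of_abs_le (f := fun i => ContinuousMap.const (X i) |a|)
    (fun i => const_mem_CLMarginal i _) fun x => (ha x).trans ?_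
  refine (le_abs_self a).trans ?_
  simpa using Finset.single_le_sum (f := fun _ : Fin n => |a|) (fun _ _ => abs_nonneg a)
    (Finset.mem_univ k)

/-- The sum `f₁(x₁) + ⋯ + fₙ(xₙ)` of functions of one coordinate each. -/
def sumProj (f : ∀ i, C(X i, ℝ)) : C(∀ i, X i, ℝ) := ∑ i, (f i).comp (proj i)

omit [∀ i, MeasurableSpace (X i)] [∀ i, BorelSpace (X i)] in
@[simp]
theorem sumProj_apply (f : ∀ i, C(X i, ℝ)) (x : ∀ i, X i) : sumProj f x = ∑ i, f i (x i) := by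
  simp [sumProj, proj]

theorem sumProj_mem_CL {f : ∀ i, C(X i, ℝ)} (hf : ∀ i, f i ∈ CLMarginal (μ i)) :
    sumProj f ∈ CL μ :=
  Submodule.sum_mem _ fun i _ => comp_proj_mem_CL (hf i)

theorem integrable_comp_proj [∀ i, SecondCountableTopology (X i)] {ρ : Measure (∀ i, X i)}
    (hρ : ∀ k, ρ.map (proj k) = μ k) {k : Fin n} {f : C(X k, ℝ)} (hf : f ∈ CLMarginal (μ k)) :
    Integrable (fun x => f (x k)) ρ := by
  have hf' : Integrable (fun y => f y) (ρ.map (proj k)) := by rw [hρ k]; exact hf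
  exact hf'.comp_measurable (proj k).continuous.measurable

theorem integral_comp_proj [∀ i, SecondCountableTopology (X i)] {ρ : Measure (∀ i, X i)}
    {ν : ∀ i, Measure (X i)}
    (hρ : ∀ k, ρ.map (proj k) = ν k) (k : Fin n) (f : C(X k, ℝ)) :
    ∫ x, f (x k) ∂ρ = ∫ y, f y ∂(ν k) := by
  rw [← hρ k, integral_map (proj k).continuous.measurable.aemeasurable]
  · rfl
  · exact f.continuous.aestronglyMeasurable

theorem integrable_of_mem_CL [∀ i, SecondCountableTopology (X i)] {ρ : Measure (∀ i, X i)}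
    (hρ : ∀ k, ρ.map (proj k) = μ k) {h : C(∀ i, X i, ℝ)} (hh : h ∈ CL μ) :
    Integrable (fun x => h x) ρ := by
  obtain ⟨f, hf, hle⟩ := hh
  exact (integrable_finsetSum Finset.univ fun i _ => integrable_comp_proj hρ (hf i)).mono'
    h.continuous.aestronglyMeasurable (Eventually.of_forall hle)

theorem integral_sumProj [∀ i, SecondCountableTopology (X i)] {ρ : Measure (∀ i, X i)}
    (hρ : ∀ k, ρ.map (proj k) = μ k) {f : ∀ i, C(X i, ℝ)} (hf : ∀ i, f i ∈ CLMarginal (μ i)) :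
    ∫ x, sumProj f x ∂ρ = ∑ i, ∫ y, f i y ∂(μ i) := by
  simp only [sumProj_apply]
  rw [integral_finsetSum _ fun i _ => integrable_comp_proj hρ (hf i)]
  exact Finset.sum_congr rfl fun i _ => integral_comp_proj hρ i (f i)

/-- A linear functional that is positive on `C_L(μ)` and restricts to integration against `μᵢ`
on functions of the `i`-th coordinate. -/
structure IsCoupling (μ : ∀ i, Measure (X i)) (Λ : C(∀ i, X i, ℝ) →ₗ[ℝ] ℝ) : Prop where
  nonneg : ∀ h ∈ CL μ, (∀ x, 0 ≤ h x) → 0 ≤ Λ h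
  map_comp_proj : ∀ k, ∀ f ∈ CLMarginal (μ k), Λ (f.comp (proj k)) = ∫ y, f y ∂(μ k)

namespace IsCoupling

variable {Λ : C(∀ i, X i, ℝ) →ₗ[ℝ] ℝ} (hΛ : IsCoupling μ Λ)

include hΛ

theorem mono {g h : C(∀ i, X i, ℝ)} (hg : g ∈ CL μ) (hh : h ∈ CL μ) (hle : ∀ x, g x ≤ h x) :
    Λ g ≤ Λ h := by
  have := hΛ.nonneg (h - g) ((CL μ).sub_mem hh hg) fun x => by simpa using hle x
  simpa using this

theorem map_sumProj {f : ∀ i, C(X i, ℝ)} (hf : ∀ i, f i ∈ CLMarginal (μ i)) :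
    Λ (sumProj f) = ∑ i, ∫ y, f i y ∂(μ i) := by
  rw [sumProj, map_sum]
  exact Finset.sum_congr rfl fun i _ => hΛ.map_comp_proj i _ (hf i)

theorem abs_le {h : C(∀ i, X i, ℝ)} (hh : h ∈ CL μ) {f : ∀ i, C(X i, ℝ)}
    (hf : ∀ i, f i ∈ CLMarginal (μ i)) (hle : ∀ x, |h x| ≤ ∑ i, f i (x i)) :
    |Λ h| ≤ ∑ i, ∫ y, f i y ∂(μ i) := by
  rw [← hΛ.map_sumProj hf, _root_.abs_le]
  have hs := sumProj_mem_CL hf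
  constructor
  · have := hΛ.mono ((CL μ).neg_mem hs) hh fun x => by
      simpa using (_root_.abs_le.1 (hle x)).1
    simpa using this
  · exact hΛ.mono hh hs fun x => by simpa using (_root_.abs_le.1 (hle x)).2

end IsCoupling

/-- Linearity of the integral is available on `C_L(μ)`; the extension beyond it is arbitrary and
carries no information. -/
theorem exists_isCoupling_integral [∀ i, SecondCountableTopology (X i)]
    {ρ : Measure (∀ i, X i)} (hρ : ∀ k, ρ.map (proj k) = μ k) :
    ∃ Λ, IsCoupling μ Λ ∧ ∀ h ∈ CL μ, Λ h = ∫ x, h x ∂ρ := by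
  let I : CL μ →ₗ[ℝ] ℝ :=
    { toFun := fun h => ∫ x, h.1 x ∂ρ
      map_add' := fun g h =>
        integral_add (integrable_of_mem_CL hρ g.2) (integrable_of_mem_CL hρ h.2)
      map_smul' := fun a h => integral_const_mul a _ }
  obtain ⟨Λ, hΛ⟩ := I.exists_extend
  have hI : ∀ h ∈ CL μ, Λ h = ∫ x, h x ∂ρ := fun h hh => LinearMap.congr_fun hΛ ⟨h, hh⟩
  refine ⟨Λ, ⟨fun h hh hpos => ?_, fun k f hf => ?_⟩, hI⟩
  · rw [hI h hh]
    exact integral_nonneg hpos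
  · rw [hI _ (comp_proj_mem_CL hf)]
    exact integral_comp_proj hρ k f

theorem tendsto_integral_posPart_sub {Y : Type*} [TopologicalSpace Y] [MeasurableSpace Y]
    [BorelSpace Y] {ν : Measure Y} {f : C(Y, ℝ)} (hf : f ∈ CLMarginal ν) :
    Tendsto (fun M : ℕ => ∫ y, max (f y - M) 0 ∂ν) atTop (𝓝 0) := by
  have hf' : Integrable (fun y => f y) ν := hf
  suffices Tendsto (fun M : ℕ => ∫ y, max (f y - M) 0 ∂ν) atTop (𝓝 (∫ _ : Y, (0 : ℝ) ∂ν)) by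
    simpa using this
  refine tendsto_integral_of_dominated_convergence (fun y => |f y|) (fun M => ?_) hf'.abs
    (fun M => Eventually.of_forall fun y => ?_) (Eventually.of_forall fun y => ?_)
  · exact ((hf'.aestronglyMeasurable.sub aestronglyMeasurable_const).sup
      aestronglyMeasurable_const)
  · rw [Real.norm_eq_abs, abs_of_nonneg (le_max_right _ _)]
    exact max_le ((sub_le_self _ M.cast_nonneg).trans (le_abs_self _)) (abs_nonneg _)
  · refine tendsto_const_nhds.congr' ?_
    obtain ⟨N, hN⟩ := exists_nat_ge (f y)
    filter_upwards [eventually_ge_atTop N] with M hM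
    have : (N : ℝ) ≤ M := by exact_mod_cast hM
    exact (max_eq_right (by linarith)).symm

/-- Truncation of `h` leaves an error dominated by `∑ (fᵢ - M)⁺`, on which both functionals depend
only through the marginals and which vanishes as `M → ∞`. -/
theorem IsCoupling.eq_of_eqOn_bounded [∀ i, IsFiniteMeasure (μ i)]
    {Λ Λ' : C(∀ i, X i, ℝ) →ₗ[ℝ] ℝ}
    (hΛ : IsCoupling μ Λ) (hΛ' : IsCoupling μ Λ')
    (heq : ∀ (g : C(∀ i, X i, ℝ)) (a : ℝ), (∀ x, |g x| ≤ a) → Λ g = Λ' g)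
    {h : C(∀ i, X i, ℝ)} (hh : h ∈ CL μ) : Λ h = Λ' h := by
  obtain ⟨f, hf, hle⟩ := id hh
  let t : ℕ → ∀ i, C(X i, ℝ) := fun M i => (f i - ContinuousMap.const _ (M : ℝ)) ⊔ 0
  have ht : ∀ M i, t M i ∈ CLMarginal (μ i) := fun M i =>
    Integrable.pos_part (f := fun y => f i y - M) ((hf i).sub (integrable_const _))
  -- The level is `n * M` because `∑ fᵢ - n * M ≤ ∑ (fᵢ - M)⁺`.
  let g : ℕ → C(∀ i, X i, ℝ) := fun M =>
    (h ⊓ ContinuousMap.const _ (n * M : ℝ)) ⊔ ContinuousMap.const _ (-(n * M : ℝ))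
  have hgb : ∀ M x, |g M x| ≤ n * M := by
    intro M x
    have h0 : (0 : ℝ) ≤ n * M := by positivity
    simp only [g, ContinuousMap.sup_apply, ContinuousMap.inf_apply, ContinuousMap.const_apply]
    exact _root_.abs_le.2 ⟨le_max_right _ _, max_le (min_le_right _ _) (by linarith)⟩
  have hgt : ∀ M x, |(h - g M) x| ≤ ∑ i, t M i (x i) := by
    intro M x
    have h0 : (0 : ℝ) ≤ n * M := by positivity
    have h1 : ∑ i, f i (x i) - n * M ≤ ∑ i, t M i (x i) := by
      have : ∑ i, (f i (x i) - M) ≤ ∑ i, t M i (x i) :=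
        Finset.sum_le_sum fun i _ => by simp [t]
      simpa using this
    have h2 : 0 ≤ ∑ i, t M i (x i) := Finset.sum_nonneg fun i _ => by simp [t]
    have h3 := _root_.abs_le.1 (hle x)
    simp only [g, ContinuousMap.sub_apply, ContinuousMap.sup_apply, ContinuousMap.inf_apply,
      ContinuousMap.const_apply]
    rw [_root_.abs_le]
    rcases max_cases (min (h x) (n * M : ℝ)) (-(n * M : ℝ)) with h4 | h4 <;>
      rcases min_cases (h x) (n * M : ℝ) with h5 | h5 <;> constructor <;> linarith
  have hgCL : ∀ M, h - g M ∈ CL μ := fun M => mem_CL_of_abs_le (ht M) (hgt M)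
  have hbound : ∀ M, |Λ h - Λ' h| ≤ 2 * ∑ i, ∫ y, t M i y ∂(μ i) := by
    intro M
    have h1 := hΛ.abs_le (hgCL M) (ht M) (hgt M)
    have h2 := hΛ'.abs_le (hgCL M) (ht M) (hgt M)
    rw [map_sub, _root_.abs_le] at h1 h2
    rw [heq (g M) _ (hgb M)] at h1
    rw [_root_.abs_le]
    constructor <;> linarith [h1.1, h1.2, h2.1, h2.2]
  have hlim : Tendsto (fun M => 2 * ∑ i, ∫ y, t M i y ∂(μ i)) atTop (𝓝 0) := by
    have := (tendsto_finsetSum Finset.univ fun i _ =>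
      tendsto_integral_posPart_sub (hf i)).const_mul 2
    simpa [t] using this
  have := ge_of_tendsto' hlim hbound
  exact sub_eq_zero.1 (abs_nonpos_iff.1 this)

end

/-! ### Tightness from the marginals and representation by plans -/

theorem exists_isCompact_measureReal_compl_le {Y : Type*} [TopologicalSpace Y] [PolishSpace Y]
    [MeasurableSpace Y] [BorelSpace Y] (ν : Measure Y) [IsFiniteMeasure ν] {δ : ℝ} (hδ : 0 < δ) :
    ∃ K : Set Y, IsCompact K ∧ ν.real Kᶜ ≤ δ := by
  obtain ⟨K, hK, hKν⟩ := isTightMeasureSet_iff_exists_isCompact_measure_compl_le.1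
    (isTightMeasureSet_singleton (μ := ν)) (ENNReal.ofReal δ) (by simpa using hδ)
  exact ⟨K, hK, ENNReal.toReal_le_of_le_ofReal hδ.le (hKν ν rfl)⟩

theorem integral_le_measureReal_compl {Y : Type*} [TopologicalSpace Y] [T2Space Y]
    [MeasurableSpace Y] [BorelSpace Y] (ν : Measure Y) [IsFiniteMeasure ν] {K : Set Y}
    (hK : IsCompact K) {φ : C(Y, ℝ)} (hφ : ∀ y, φ y ∈ Set.Icc (0 : ℝ) 1)
    (hφK : ∀ y ∈ K, φ y = 0) : Integrable (fun y => φ y) ν ∧ ∫ y, φ y ∂ν ≤ ν.real Kᶜ := by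
  have hint : Integrable (fun y => φ y) ν :=
    (integrable_const (1 : ℝ)).mono' φ.continuous.aestronglyMeasurable
      (Eventually.of_forall fun y => by
        rw [Real.norm_eq_abs, abs_of_nonneg (hφ y).1]; exact (hφ y).2)
  refine ⟨hint, ?_⟩
  have hm : MeasurableSet Kᶜ := hK.isClosed.measurableSet.compl
  rw [← integral_indicator_one hm]
  refine integral_mono hint ((integrable_const (1 : ℝ)).indicator hm) fun y => ?_
  by_cases hy : y ∈ K
  · simp [hφK y hy, hy]
  · simpa [hy] using (hφ y).2

section

variable {n : ℕ} {X : Fin n → Type*} [∀ i, TopologicalSpace (X i)] [∀ i, PolishSpace (X i)]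
  [∀ i, MeasurableSpace (X i)] [∀ i, BorelSpace (X i)] {μ : ∀ i, Measure (X i)}
  [∀ i, IsProbabilityMeasure (μ i)]

theorem IsCoupling.exists_isCompact_apply_le {Λ : C(∀ i, X i, ℝ) →ₗ[ℝ] ℝ}
    (hΛ : IsCoupling μ Λ) (k₀ : Fin n) {ε : ℝ} (hε : 0 < ε) :
    ∃ K : Set (∀ i, X i), IsCompact K ∧ ∀ g : C(∀ i, X i, ℝ),
      (∀ x, g x ∈ Set.Icc (0 : ℝ) 1) → (∀ x ∈ K, g x = 0) → Λ g ≤ ε := by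
  -- One share bounds `g` near the compact box; the other `n` pay for the mass of each marginal off
  -- its compact set.
  let δ : ℝ := ε / (n + 1)
  have hδ : 0 < δ := by positivity
  choose K hK hKδ using fun i => exists_isCompact_measureReal_compl_le (μ i) hδ
  refine ⟨Set.pi Set.univ K, isCompact_univ_pi hK, fun g hg hgK => ?_⟩
  obtain ⟨φ, hφ, hφK, hφU⟩ := exists_continuousMap_separating_pi K hK {x | g x < δ}
    (isOpen_lt g.continuous continuous_const) fun x hx => by simpa [hgK x hx] using hδ
  have hφL : ∀ i, φ i ∈ CLMarginal (μ i) := fun i =>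
    (integral_le_measureReal_compl (μ i) (hK i) (hφ i) (hφK i)).1
  -- A constant is read as a function of the coordinate `k₀`, so that its value under `Λ` is known.
  have hc : ContinuousMap.const (X k₀) δ ∈ CLMarginal (μ k₀) := const_mem_CLMarginal k₀ δ
  have hgCL : g ∈ CL μ := mem_CL_of_bounded k₀ (a := 1) fun x => by
    rw [abs_of_nonneg (hg x).1]; exact (hg x).2
  have hle : Λ g ≤ Λ ((ContinuousMap.const (X k₀) δ).comp (proj k₀) + sumProj φ) := by
    refine hΛ.mono hgCL ((CL μ).add_mem (comp_proj_mem_CL hc) (sumProj_mem_CL hφL)) fun x => ?_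
    have h0 : ∀ i ∈ Finset.univ, 0 ≤ φ i (x i) := fun i _ => (hφ i _).1
    by_cases hx : g x < δ
    · simpa using hx.le.trans (le_add_of_nonneg_right (Finset.sum_nonneg h0))
    · obtain ⟨i, hi⟩ := hφU x hx
      have h1 : 1 ≤ ∑ i, φ i (x i) := hi ▸ Finset.single_le_sum h0 (Finset.mem_univ i)
      have := (hg x).2
      simp only [ContinuousMap.add_apply, ContinuousMap.comp_apply, ContinuousMap.const_apply,
        sumProj_apply]
      linarith
  refine hle.trans ?_
  rw [map_add, hΛ.map_comp_proj k₀ _ hc, hΛ.map_sumProj hφL]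
  have h2 : ∑ i, ∫ y, φ i y ∂(μ i) ≤ ∑ _i : Fin n, δ := Finset.sum_le_sum fun i _ =>
    (integral_le_measureReal_compl (μ i) (hK i) (hφ i) (hφK i)).2.trans (hKδ i)
  have h3 : δ + n * δ = ε := by simp only [δ]; field_simp; ring
  simp only [ContinuousMap.const_apply, integral_const, probReal_univ, one_smul]
  simp only [Finset.sum_const, Finset.card_univ, Fintype.card_fin, nsmul_eq_mul] at h2
  linarith

/-- Every coupling functional is integration against a measure with marginals `μᵢ`. -/
theorem IsCoupling.exists_measure {Λ : C(∀ i, X i, ℝ) →ₗ[ℝ] ℝ}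
    (hΛ : IsCoupling μ Λ) (k₀ : Fin n) :
    ∃ ρ : Measure (∀ i, X i), IsProbabilityMeasure ρ ∧ (∀ k, ρ.map (proj k) = μ k) ∧
      ∀ h ∈ CL μ, ∫ x, h x ∂ρ = Λ h := by
  let toC : ((∀ i, X i) →ᵇ ℝ) →ₗ[ℝ] C(∀ i, X i, ℝ) :=
    { toFun := fun g => g.toContinuousMap
      map_add' := fun _ _ => rfl
      map_smul' := fun _ _ => rfl }
  have hbdd : ∀ g : (∀ i, X i) →ᵇ ℝ, toC g ∈ CL μ := fun g =>
    mem_CL_of_bounded k₀ (a := ‖g‖) g.norm_coe_le_norm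
  obtain ⟨ρ, hρfin, hρ⟩ := exists_measure_of_tight_functional (Λ.comp toC)
    (fun g hg => hΛ.nonneg _ (hbdd g) hg) fun ε hε => by
      obtain ⟨K, hK, hKΛ⟩ := hΛ.exists_isCompact_apply_le k₀ hε
      exact ⟨K, hK, fun g => hKΛ (toC g)⟩
  have hmarg : ∀ k, ρ.map (proj k) = μ k := by
    intro k
    have hm := (proj (X := X) k).continuous.measurable.aemeasurable (μ := ρ)
    refine ext_of_forall_integral_eq_of_IsFiniteMeasure fun f => ?_
    rw [integral_map hm f.continuous.aestronglyMeasurable]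
    have hf : f.toContinuousMap ∈ CLMarginal (μ k) := f.integrable (μ k)
    exact (hρ (f.compContinuous (proj k))).trans (hΛ.map_comp_proj k _ hf)
  refine ⟨ρ, ⟨?_⟩, hmarg, fun h hh => ?_⟩
  · have := congrArg (fun ν => ν Set.univ) (hmarg k₀)
    simpa [Measure.map_apply (proj (X := X) k₀).continuous.measurable MeasurableSet.univ] using this
  -- `ρ` represents `Λ` on bounded functions so far; truncation carries this over to all of
  -- `C_L(μ)`.
  · obtain ⟨Λ', hΛ', hI⟩ := exists_isCoupling_integral hmarg
    rw [← hI h hh]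
    refine hΛ'.eq_of_eqOn_bounded hΛ (fun g a ha => ?_) hh
    rw [hI g (mem_CL_of_bounded k₀ ha)]
    exact hρ (BoundedContinuousFunction.ofNormedAddCommGroup g g.continuous a ha)

end

/-! ### Hahn–Banach and duality -/

theorem exists_linearMap_le_sublinear_apply_eq {E : Type*} [AddCommGroup E] [Module ℝ E]
    (N : E → ℝ) (N_hom : ∀ a : ℝ, 0 < a → ∀ x, N (a • x) = a * N x)
    (N_add : ∀ x y, N (x + y) ≤ N x + N y) (x₀ : E) :
    ∃ g : E →ₗ[ℝ] ℝ, g x₀ = N x₀ ∧ ∀ x, g x ≤ N x := by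
  have N_zero : N 0 = 0 := by
    have := N_hom 2 two_pos 0
    rw [smul_zero] at this
    linarith
  have H : ∀ a : ℝ, a • x₀ = 0 → (RingHom.id ℝ) a • N x₀ = 0 := by
    intro a ha
    rcases smul_eq_zero.1 ha with h | h
    · simp [h]
    · simp [h, N_zero]
  obtain ⟨g, hg, hgN⟩ := exists_extension_of_le_sublinear
    (LinearPMap.mkSpanSingleton' x₀ (N x₀) H) N N_hom N_add (by
      rintro ⟨x, hx⟩
      obtain ⟨a, rfl⟩ := Submodule.mem_span_singleton.1 hx
      rw [LinearPMap.mkSpanSingleton'_apply]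
      change a * N x₀ ≤ N (a • x₀)
      rcases lt_trichotomy a 0 with ha | rfl | ha
      -- For negative `a`, subadditivity gives `0 = N 0 ≤ N (a • x₀) + N (-a • x₀)`.
      · have h1 := N_add (a • x₀) ((-a) • x₀)
        rw [N_hom (-a) (neg_pos.2 ha), ← add_smul, add_neg_cancel, zero_smul, N_zero] at h1
        linarith
      · simp [N_zero]
      · exact (N_hom a ha x₀).ge)
  refine ⟨g, ?_, hgN⟩
  exact (hg ⟨x₀, Submodule.mem_span_singleton_self x₀⟩).trans
    (LinearPMap.mkSpanSingleton'_apply_self x₀ (N x₀) H _)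

section

variable {n : ℕ} {X : Fin n → Type*} [∀ i, TopologicalSpace (X i)]
  [∀ i, MeasurableSpace (X i)] [∀ i, BorelSpace (X i)]

/-- The values `∑ ∫ fᵢ dμᵢ` over all `f` and `w ∈ W` with `h ≤ ∑ fᵢ(xᵢ) + w`. -/
def dualValues (μ : ∀ i, Measure (X i)) (W : Submodule ℝ C(∀ i, X i, ℝ))
    (h : C(∀ i, X i, ℝ)) : Set ℝ :=
  {r | ∃ f : ∀ i, C(X i, ℝ), (∀ i, f i ∈ CLMarginal (μ i)) ∧ ∃ w ∈ W,
    (∀ x, h x ≤ sumProj f x + w x) ∧ r = ∑ i, ∫ y, f i y ∂(μ i)}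

variable {μ : ∀ i, Measure (X i)} {W : Submodule ℝ C(∀ i, X i, ℝ)}

theorem dualValues_nonempty {h : C(∀ i, X i, ℝ)} (hh : h ∈ CL μ) :
    (dualValues μ W h).Nonempty := by
  obtain ⟨f, hf, hle⟩ := hh
  exact ⟨_, f, hf, 0, W.zero_mem, fun x => by simpa using (abs_le.1 (hle x)).2, rfl⟩

theorem smul_mem_dualValues {h : C(∀ i, X i, ℝ)} {a r : ℝ} (ha : 0 ≤ a)
    (hr : r ∈ dualValues μ W h) : a * r ∈ dualValues μ W (a • h) := by
  obtain ⟨f, hf, w, hw, hle, rfl⟩ := hr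
  refine ⟨fun i => a • f i, fun i => (CLMarginal (μ i)).smul_mem a (hf i), a • w,
    W.smul_mem a hw, fun x => ?_, ?_⟩
  · have := mul_le_mul_of_nonneg_left (hle x) ha
    simpa [Finset.mul_sum, mul_add] using this
  · simp [Finset.mul_sum, integral_const_mul]

theorem add_mem_dualValues {g h : C(∀ i, X i, ℝ)} {r s : ℝ}
    (hr : r ∈ dualValues μ W g) (hs : s ∈ dualValues μ W h) :
    r + s ∈ dualValues μ W (g + h) := by
  obtain ⟨f, hf, w, hw, hle, rfl⟩ := hr
  obtain ⟨f', hf', w', hw', hle', rfl⟩ := hs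
  refine ⟨fun i => f i + f' i, fun i => (CLMarginal (μ i)).add_mem (hf i) (hf' i), w + w',
    W.add_mem hw hw', fun x => ?_, ?_⟩
  · have h1 := hle x
    have h2 := hle' x
    simp only [sumProj_apply] at h1 h2
    simp only [sumProj_apply, ContinuousMap.add_apply, Finset.sum_add_distrib]
    linarith
  · rw [← Finset.sum_add_distrib]
    exact Finset.sum_congr rfl fun i _ => (integral_add (hf i) (hf' i)).symm

theorem integral_le_of_mem_dualValues [∀ i, SecondCountableTopology (X i)]
    (hW : W ≤ CL μ) {π : Measure (∀ i, X i)} (hπ : π ∈ PlansVanishingOn μ W)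
    {h : C(∀ i, X i, ℝ)} (hh : h ∈ CL μ) {r : ℝ} (hr : r ∈ dualValues μ W h) :
    ∫ x, h x ∂π ≤ r := by
  obtain ⟨f, hf, w, hw, hle, rfl⟩ := hr
  obtain ⟨_, hmarg, hπW⟩ := hπ
  have hfi := integrable_of_mem_CL hmarg (sumProj_mem_CL hf)
  have hwi := integrable_of_mem_CL hmarg (hW hw)
  calc ∫ x, h x ∂π ≤ ∫ x, (sumProj f x + w x) ∂π :=
        integral_mono (integrable_of_mem_CL hmarg hh) (hfi.add hwi) hle
    _ = ∑ i, ∫ y, f i y ∂(μ i) := by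
      rw [integral_add hfi hwi, hπW w hw, add_zero, integral_sumProj hmarg hf]

theorem bddBelow_dualValues [∀ i, SecondCountableTopology (X i)]
    (hW : W ≤ CL μ) {π : Measure (∀ i, X i)} (hπ : π ∈ PlansVanishingOn μ W)
    {h : C(∀ i, X i, ℝ)} (hh : h ∈ CL μ) : BddBelow (dualValues μ W h) :=
  ⟨_, fun _ hr => integral_le_of_mem_dualValues hW hπ hh hr⟩

theorem smul_dualValues {h : C(∀ i, X i, ℝ)} {a : ℝ} (ha : 0 < a) :
    dualValues μ W (a • h) = (fun r => a * r) '' dualValues μ W h := by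
  ext r
  constructor
  · intro hr
    have := smul_mem_dualValues (inv_nonneg.2 ha.le) hr
    rw [smul_smul, inv_mul_cancel₀ ha.ne', one_smul] at this
    exact ⟨_, this, by simp [ha.ne']⟩
  · rintro ⟨s, hs, rfl⟩
    exact smul_mem_dualValues ha.le hs

/-- The plan `π` bounds the dual values below, so their infimum is a genuine sublinear function. For
a functional below it, each required property follows by exhibiting explicit dual values of `h`,
`-h` or both. -/
theorem exists_isCoupling_apply_eq_sInf [∀ i, SecondCountableTopology (X i)]
    (hW : W ≤ CL μ) {π : Measure (∀ i, X i)} (hπ : π ∈ PlansVanishingOn μ W)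
    {h₀ : C(∀ i, X i, ℝ)} (hh₀ : h₀ ∈ CL μ) :
    ∃ Λ, IsCoupling μ Λ ∧ (∀ w ∈ W, Λ w = 0) ∧ Λ h₀ = sInf (dualValues μ W h₀) := by
  let N : CL μ → ℝ := fun h => sInf (dualValues μ W h.1)
  have hN : ∀ (h : CL μ) {r : ℝ}, r ∈ dualValues μ W h.1 → N h ≤ r := fun h _ hr =>
    csInf_le (bddBelow_dualValues hW hπ h.2) hr
  obtain ⟨g, hg₀, hgN⟩ := exists_linearMap_le_sublinear_apply_eq N
    (fun a ha h => by
      change sInf (dualValues μ W (a • h.1)) = _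
      rw [smul_dualValues ha]
      exact Real.sInf_smul_of_nonneg ha.le _)
    (fun h h' => by
      have h1 := dualValues_nonempty (W := W) h.2
      have h2 := dualValues_nonempty (W := W) h'.2
      have h3 := bddBelow_dualValues hW hπ h.2
      have h4 := bddBelow_dualValues hW hπ h'.2
      change N (h + h') ≤ sInf _ + sInf _
      rw [← csInf_add h1 h3 h2 h4]
      refine le_csInf (h1.add h2) ?_
      rintro _ ⟨r, hr, s, hs, rfl⟩
      exact hN _ (add_mem_dualValues hr hs))
    ⟨h₀, hh₀⟩
  obtain ⟨Λ, hΛ⟩ := g.exists_extend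
  have hΛg : ∀ h (hh : h ∈ CL μ), Λ h = g ⟨h, hh⟩ := fun h hh => LinearMap.congr_fun hΛ ⟨h, hh⟩
  have hle : ∀ h ∈ CL μ, ∀ r ∈ dualValues μ W h, Λ h ≤ r := fun h hh r hr => by
    rw [hΛg h hh]
    exact (hgN _).trans (hN ⟨h, hh⟩ hr)
  have hneg : ∀ h ∈ CL μ, (∀ r ∈ dualValues μ W (-h), -Λ h ≤ r) := fun h hh r hr => by
    rw [← map_neg]
    exact hle _ ((CL μ).neg_mem hh) r hr
  have hzero : ∀ k : Fin n, (0 : C(X k, ℝ)) ∈ CLMarginal (μ k) := fun k =>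
    (CLMarginal (μ k)).zero_mem
  refine ⟨Λ, ⟨fun h hh hpos => ?_, fun k f hf => ?_⟩, fun w hw => ?_, ?_⟩
  · have := hneg h hh 0 ⟨fun i => 0, hzero, 0, W.zero_mem, fun x => by simpa using hpos x, by simp⟩
    linarith
  · classical
    have hs : ∀ f ∈ CLMarginal (μ k), ∫ y, f y ∂(μ k) ∈ dualValues μ W (f.comp (proj k)) := by
      intro f hf
      refine ⟨Pi.single k f, fun i => ?_, 0, W.zero_mem, fun x => ?_, ?_⟩
      · rcases eq_or_ne i k with rfl | hik
        · simpa using hf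
        · simp [hik]
      · rw [sumProj_apply, Finset.sum_eq_single k]
        · simp [proj]
        · intro i _ hik
          simp [hik]
        · simp
      · rw [Finset.sum_eq_single k]
        · simp
        · intro i _ hik
          simp [hik]
        · simp
    refine le_antisymm (hle _ (comp_proj_mem_CL hf) _ (hs f hf)) ?_
    have h1 := hneg _ (comp_proj_mem_CL hf) _ (hs (-f) ((CLMarginal (μ k)).neg_mem hf))
    simp only [ContinuousMap.neg_apply, integral_neg] at h1
    linarith
  · have h1 := hle w (hW hw) 0 ⟨fun i => 0, hzero, w, hw, fun x => by simp, by simp⟩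
    have h2 := hneg w (hW hw) 0 ⟨fun i => 0, hzero, -w, W.neg_mem hw, fun x => by simp, by simp⟩
    linarith
  · rw [hΛg h₀ hh₀, hg₀]

/-- Approximate complementary slackness: a minimizer admits admissible dual potentials whose
total slack is arbitrarily small. -/
theorem exists_dual_slack_le [∀ i, PolishSpace (X i)] [∀ i, IsProbabilityMeasure (μ i)]
    (k₀ : Fin n) (hW : W ≤ CL μ) {c : C(∀ i, X i, ℝ)} (hc : c ∈ CL μ)
    {π : Measure (∀ i, X i)} (hπ : π ∈ PlansVanishingOn μ W)
    (hmin : IsMinOn (fun ρ : Measure (∀ i, X i) => ∫ x, c x ∂ρ) (PlansVanishingOn μ W) π)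
    {ε : ℝ} (hε : 0 < ε) :
    ∃ f : ∀ i, C(X i, ℝ), (∀ i, f i ∈ CLMarginal (μ i)) ∧ ∃ w ∈ W,
      (∀ x, 0 ≤ (c + (sumProj f + w)) x) ∧ ∫ x, (c + (sumProj f + w)) x ∂π ≤ ε := by
  have hc' : -c ∈ CL μ := (CL μ).neg_mem hc
  -- The sign is reversed since dual values bound integrals from above. The plan `ρ` representing
  -- `Λ` is a competitor, so the infimum `-∫ c dρ` is at most `-∫ c dπ`.
  obtain ⟨Λ, hΛ, hΛW, hΛc⟩ := exists_isCoupling_apply_eq_sInf hW hπ hc'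
  obtain ⟨ρ, hρ, hρμ, hρΛ⟩ := hΛ.exists_measure k₀
  have hle : ∫ x, c x ∂π ≤ ∫ x, c x ∂ρ :=
    hmin ⟨hρ, hρμ, fun w hw => (hρΛ w (hW hw)).trans (hΛW w hw)⟩
  rw [hρΛ c hc] at hle
  have hlt : sInf (dualValues μ W (-c)) < -∫ x, c x ∂π + ε := by
    rw [← hΛc, map_neg]
    linarith
  obtain ⟨r, ⟨f, hf, w, hw, hfw, rfl⟩, hr⟩ :=
    exists_lt_of_csInf_lt (dualValues_nonempty hc') hlt
  obtain ⟨_, hmarg, hπW⟩ := hπ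
  have hci := integrable_of_mem_CL hmarg hc
  have hfi := integrable_of_mem_CL hmarg (sumProj_mem_CL hf)
  have hwi := integrable_of_mem_CL hmarg (hW hw)
  refine ⟨f, hf, w, hw, fun x => ?_, ?_⟩
  · have := hfw x
    simp only [ContinuousMap.neg_apply] at this
    simp only [ContinuousMap.add_apply]
    linarith
  · have : ∫ x, (c + (sumProj f + w)) x ∂π =
        ∫ x, c x ∂π + (∫ x, sumProj f x ∂π + ∫ x, w x ∂π) := by
      rw [← integral_add hfi hwi]
      exact integral_add hci (hfi.add hwi)
    rw [this, hπW w hw, integral_sumProj hmarg hf]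
    linarith

end

/-! ### Finitely supported competitors and monotone sets -/

theorem integrable_of_measure_compl_finset_eq_zero {Y : Type*} [TopologicalSpace Y] [T1Space Y]
    [MeasurableSpace Y] [BorelSpace Y] {ν : Measure Y} [IsFiniteMeasure ν] {S : Finset Y}
    (hS : ν (S : Set Y)ᶜ = 0) (f : Y → ℝ) : Integrable f ν := by
  have hr : ν.restrict S = ν := Measure.restrict_eq_self_of_ae_mem hS
  rw [← hr]
  exact IntegrableOn.of_finite S.finite_toSet

variable {n : ℕ} {X : Fin n → Type*} [∀ i, TopologicalSpace (X i)]
  [∀ i, MeasurableSpace (X i)] [∀ i, BorelSpace (X i)]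

/-- The marginals of `α` live on the coordinate projections of `S`, hence `α` lives on the finite
grid they span. -/
theorem WEquiv.exists_finset_measure_compl_eq_zero [∀ i, PolishSpace (X i)]
    {W : Submodule ℝ C(∀ i, X i, ℝ)} {α β : Measure (∀ i, X i)} (h : WEquiv W α β)
    {S : Finset (∀ i, X i)} (hS : β (S : Set (∀ i, X i))ᶜ = 0) :
    ∃ T : Finset (∀ i, X i), α (T : Set (∀ i, X i))ᶜ = 0 := by
  classical
  let P : ∀ i, Finset (X i) := fun i => S.image fun x => x i
  refine ⟨Fintype.piFinset P, measure_mono_null (t := ⋃ i, proj i ⁻¹' (P i : Set (X i))ᶜ)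
    (fun x hx => ?_) (measure_iUnion_null fun i => ?_)⟩
  · simpa [proj, Fintype.mem_piFinset] using hx
  · have hm : MeasurableSet (P i : Set (X i))ᶜ := (P i).measurableSet.compl
    have hp : Measurable (proj (X := X) i) := (proj i).continuous.measurable
    rw [← Measure.map_apply hp hm, h.1 i, Measure.map_apply hp hm]
    refine measure_mono_null (t := (S : Set (∀ i, X i))ᶜ) (fun x hx hxS => hx ?_) hS
    exact Finset.mem_coe.2 (Finset.mem_image_of_mem _ hxS)

theorem WEquiv.isFiniteMeasure [∀ i, PolishSpace (X i)]
    {W : Submodule ℝ C(∀ i, X i, ℝ)} {α β : Measure (∀ i, X i)} (h : WEquiv W α β)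
    [IsFiniteMeasure β] (k : Fin n) : IsFiniteMeasure α := by
  refine ⟨?_⟩
  have hp : Measurable (proj (X := X) k) := (proj k).continuous.measurable
  have := congrArg (fun ν => ν Set.univ) (h.1 k)
  simp only [Measure.map_apply hp MeasurableSet.univ, Set.preimage_univ] at this
  rw [this]
  exact measure_lt_top _ _

/-- A set on which the slacks of a sequence of admissible dual potentials tend to zero is
`(c, W)`-monotone. -/
theorem isCWMonotone_of_tendsto_slack [∀ i, PolishSpace (X i)] (k₀ : Fin n)
    {c : C(∀ i, X i, ℝ)} {W : Submodule ℝ C(∀ i, X i, ℝ)} {Γ : Set (∀ i, X i)}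
    (f : ℕ → ∀ i, C(X i, ℝ)) (w : ℕ → C(∀ i, X i, ℝ)) (hw : ∀ m, w m ∈ W)
    (hpos : ∀ m x, 0 ≤ (c + (sumProj (f m) + w m)) x)
    (hΓ : ∀ x ∈ Γ, Tendsto (fun m => (c + (sumProj (f m) + w m)) x) atTop (𝓝 0)) :
    IsCWMonotone (fun x => c x) W Γ := by
  intro S hSΓ β hβ hβS α hα
  have hSβ : β (S : Set (∀ i, X i))ᶜ = 0 := hβS ▸ Measure.measure_compl_support
  obtain ⟨T, hT⟩ := hα.exists_finset_measure_compl_eq_zero hSβ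
  have := hα.isFiniteMeasure k₀
  have hiα : ∀ g : (∀ i, X i) → ℝ, Integrable g α :=
    integrable_of_measure_compl_finset_eq_zero hT
  have hiβ : ∀ g : (∀ i, X i) → ℝ, Integrable g β :=
    integrable_of_measure_compl_finset_eq_zero hSβ
  have hdual : ∀ m, ∫ x, (sumProj (f m) + w m) x ∂α = ∫ x, (sumProj (f m) + w m) x ∂β := by
    intro m
    simp only [ContinuousMap.add_apply, sumProj_apply]
    rw [integral_add (hiα _) (hiα _), integral_add (hiβ _) (hiβ _),
      integral_finsetSum _ fun i _ => hiα _, integral_finsetSum _ fun i _ => hiβ _,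
      hα.2 _ (hw m)]
    congr 1
    refine Finset.sum_congr rfl fun i _ => ?_
    rw [integral_comp_proj hα.1 i (f m i), integral_comp_proj (fun _ => rfl) i (f m i)]
  have hstep : ∀ m, ∫ x, c x ∂β - ∫ x, (c + (sumProj (f m) + w m)) x ∂β ≤ ∫ x, c x ∂α := by
    intro m
    have h1 : 0 ≤ ∫ x, (c + (sumProj (f m) + w m)) x ∂α := integral_nonneg (hpos m)
    have h2 : ∫ x, (c + (sumProj (f m) + w m)) x ∂α =
        ∫ x, c x ∂α + ∫ x, (sumProj (f m) + w m) x ∂α := integral_add (hiα _) (hiα _)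
    have h3 : ∫ x, (c + (sumProj (f m) + w m)) x ∂β =
        ∫ x, c x ∂β + ∫ x, (sumProj (f m) + w m) x ∂β := integral_add (hiβ _) (hiβ _)
    have := hdual m
    linarith
  -- The integral is a finite sum over `S`, so pointwise convergence on `S ⊆ Γ` suffices, without
  -- domination.
  have hlim : Tendsto (fun m => ∫ x, (c + (sumProj (f m) + w m)) x ∂β) atTop (𝓝 0) := by
    have hsum : ∀ g : (∀ i, X i) → ℝ, ∫ x, g x ∂β = ∑ x ∈ S, β.real {x} * g x := by
      intro g
      have hr : β.restrict S = β := Measure.restrict_eq_self_of_ae_mem hSβ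
      conv_lhs => rw [← hr]
      simpa using setIntegral_finset (s := S) (f := g) (hiβ g).integrableOn
    simp only [hsum]
    have := tendsto_finsetSum S fun x hx => (hΓ x (hSΓ hx)).const_mul (β.real {x})
    simpa using this
  have hlim' := (tendsto_const_nhds (x := ∫ x, c x ∂β)).sub hlim
  rw [sub_zero] at hlim'
  exact le_of_tendsto' hlim' hstep

theorem exists_subseq_tendsto_ae_of_integral_tendsto_zero {Y : Type*} [MeasurableSpace Y]
    {ν : Measure Y} {u : ℕ → Y → ℝ} (hu : ∀ m, Integrable (u m) ν) (hpos : ∀ m y, 0 ≤ u m y)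
    (hlim : Tendsto (fun m => ∫ y, u m y ∂ν) atTop (𝓝 0)) :
    ∃ φ : ℕ → ℕ, ∀ᵐ y ∂ν, Tendsto (fun m => u (φ m) y) atTop (𝓝 0) := by
  have hL1 : Tendsto (fun m => eLpNorm (u m - 0) 1 ν) atTop (𝓝 0) := by
    have h := ENNReal.tendsto_ofReal hlim
    rw [ENNReal.ofReal_zero] at h
    refine h.congr fun m => ?_
    rw [sub_zero, eLpNorm_one_eq_lintegral_enorm, ofReal_integral_eq_lintegral_ofReal (hu m)
      (Eventually.of_forall (hpos m))]
    exact lintegral_congr fun y => (Real.enorm_of_nonneg (hpos m y)).symm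
  obtain ⟨φ, _, hφ⟩ := (tendstoInMeasure_of_tendsto_eLpNorm one_ne_zero
    (fun m => (hu m).aestronglyMeasurable) aestronglyMeasurable_zero hL1).exists_seq_tendsto_ae
  exact ⟨φ, hφ⟩

theorem CL_eq_bot_of_isEmpty [IsEmpty (Fin n)] (μ : ∀ i, Measure (X i)) : CL μ = ⊥ := by
  refine (Submodule.eq_bot_iff _).2 ?_
  rintro h ⟨f, -, hle⟩
  ext x
  simpa using hle x

end ConstrainedTransport

end

open MeasureTheory ConstrainedTransport Filter Topology in
theorem mainTheorem2 {n : ℕ} {X : Fin n → Type*} [∀ i, TopologicalSpace (X i)]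
    [∀ i, PolishSpace (X i)] [∀ i, MeasurableSpace (X i)] [∀ i, BorelSpace (X i)]
    (μ : ∀ i, Measure (X i)) [∀ i, IsProbabilityMeasure (μ i)]
    (c : C(∀ i, X i, ℝ)) (hc : c ∈ ConstrainedTransport.CL μ)
    (W : Submodule ℝ C(∀ i, X i, ℝ)) (hW : W ≤ ConstrainedTransport.CL μ)
    (hμW : ∀ k, ∀ f ∈ ConstrainedTransport.CLMarginal (μ k),
      f.comp (ConstrainedTransport.proj k) ∈ W → ∫ y, f y ∂(μ k) = 0)
    (π : Measure (∀ i, X i)) (hπ : π ∈ ConstrainedTransport.PlansVanishingOn μ W)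
    (hmin : IsMinOn (fun ρ : Measure (∀ i, X i) => ∫ x, c x ∂ρ)
      (ConstrainedTransport.PlansVanishingOn μ W) π) :
    ConstrainedTransport.IsCWMonotonePlan μ (fun x => c x) W π := by
  have := hπ.1
  refine ⟨hπ, ?_⟩
  rcases isEmpty_or_nonempty (Fin n) with hn | ⟨⟨k₀⟩⟩
  -- With no factors the bound by an empty sum forces `c = 0`. Otherwise a coordinate `k₀` exists,
  -- which gives access to constants and total mass.
  · rw [CL_eq_bot_of_isEmpty, Submodule.mem_bot] at hc
    exact ⟨Set.univ, MeasurableSet.univ, measure_univ, fun S _ β _ _ α _ => by simp [hc]⟩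
  have hε : ∀ m : ℕ, (0 : ℝ) < 1 / ((m : ℝ) + 1) := fun m => Nat.one_div_pos_of_nat
  choose f hf w hw hpos hint using fun m => exists_dual_slack_le k₀ hW hc hπ hmin (hε m)
  have hi : ∀ m, Integrable (fun x => (c + (sumProj (f m) + w m)) x) π := fun m =>
    integrable_of_mem_CL hπ.2.1
      ((CL μ).add_mem hc ((CL μ).add_mem (sumProj_mem_CL (hf m)) (hW (hw m))))
  obtain ⟨φ, hφ⟩ := exists_subseq_tendsto_ae_of_integral_tendsto_zero hi hpos
    (squeeze_zero (fun m => integral_nonneg (hpos m)) hint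
      tendsto_one_div_add_atTop_nhds_zero_nat)
  have hΓ : MeasurableSet
      {x | Tendsto (fun m => (c + (sumProj (f (φ m)) + w (φ m))) x) atTop (𝓝 0)} :=
    measurableSet_tendsto _ fun m => (c + (sumProj (f (φ m)) + w (φ m))).continuous.measurable
  exact ⟨_, hΓ, (mem_ae_iff_prob_eq_one hΓ).1 hφ,
    isCWMonotone_of_tendsto_slack k₀ (fun m => f (φ m)) (fun m => w (φ m)) (fun m => hw _)
      (fun m => hpos _) fun x hx => hx⟩
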